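/- Let $p,q\ge 1$ and $1\le r\le p$ be integers, and let $\mathbb C^{p+q}$ carry the Hermitian form $v\mapsto v^H H_{p,q}v$, where $H_{p,q}=\begin{pmatrix}I_p&0\\0&-I_q\end{pmatrix}$. Let $Gr(r,\mathbb C^{p+q})$ be the Grassmannian of $r$-dimensional complex linear subspaces ($r$-planes) of $\mathbb C^{p+q}$, with its standard structure of a complex manifold, and let $D^r_{p,q}\subset Gr(r,\mathbb C^{p+q})$ be the set of the $r$-planes on which $H_{p,q}$ is positive definite. A map $f:D^r_{p,q}\to D^r_{p,q}$ is called a linear self map if there is a matrix $M\in M_{p+q}(\mathbb C)$ with $f(W)=M(W)=\{Mz: z\in W\}$ for every $W\in D^r_{p,q}$; it is called minimal if it is given in this way by a matrix $M$ of rank $p$, and non-minimal otherwise. Theorem. Every non-minimal linear self map of $D^r_{p,q}$ extends holomorphically to an open neighbourhood of the closure of $D^r_{p,q}$ in $Gr(r,\mathbb C^{p+q})$; that is, for every non-minimal linear self map $f$ of $D^r_{p,q}$ there are an open set $U\subset Gr(r,\mathbb C^{p+q})$ containing $\overline{D^r_{p,q}}$ and a holomorphic map $F:U\to Gr(r,\mathbb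 C^{p+q})$ with $F|_{D^r_{p,q}}=f$. -/

import Mathlib

open scoped Manifold ContDiff

noncomputable section

/-! ### The complex Grassmannian as a complex manifold -/

section Grassmannian

/-- `Gr r V`: the Grassmannian of `r`-dimensional complex linear subspaces of `V`. -/
def Gr (r : ℕ) (V : Type*) [AddCommGroup V] [Module ℂ V] : Type _ :=
  {W : Submodule ℂ V // Module.finrank ℂ W = r}

namespace Gr

variable {r : ℕ} {V : Type*} [NormedAddCommGroup V] [NormedSpace ℂ V]

/-- An `r`-frame in `V`: an injective linear map `ℂ^r → V` (with the operator norm topology). -/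
def Frame (r : ℕ) (V : Type*) [NormedAddCommGroup V] [NormedSpace ℂ V] : Type _ :=
  {f : (Fin r → ℂ) →L[ℂ] V // Function.Injective f}

instance : TopologicalSpace (Frame r V) :=
  inferInstanceAs (TopologicalSpace {f : (Fin r → ℂ) →L[ℂ] V // Function.Injective f})

/-- The `r`-plane spanned by a frame. -/
def ofFrame (f : Frame r V) : Gr r V :=
  ⟨LinearMap.range (f.1 : (Fin r → ℂ) →ₗ[ℂ] V), by
    have h : Function.Injective (f.1 : (Fin r → ℂ) →ₗ[ℂ] V) := f.2
    rw [LinearMap.finrank_range_of_inj h, Module.finrank_fin_fun]⟩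

/-- The topology of the Grassmannian: the quotient topology from the space of frames. -/
instance : TopologicalSpace (Gr r V) :=
  TopologicalSpace.coinduced ofFrame inferInstance

/-- The space on which the Grassmannian is modelled: linear maps `ℂ^r → ℂ^(n-r)`,
where `n = dim V`. -/
abbrev Model (r : ℕ) (V : Type*) [NormedAddCommGroup V] [NormedSpace ℂ V] : Type :=
  (Fin r → ℂ) →L[ℂ] (Fin (Module.finrank ℂ V - r) → ℂ)

/-- A linear splitting `ℂ^r × ℂ^(n-r) ≃ V`; the standard charts are indexed by these. -/
abbrev Splitting (r : ℕ) (V : Type*) [NormedAddCommGroup V] [NormedSpace ℂ V] : Type _ :=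
  ((Fin r → ℂ) × (Fin (Module.finrank ℂ V - r) → ℂ)) ≃L[ℂ] V

/-- The frame `x ↦ e (x, A x)`. -/
def graphFrame (e : Splitting r V) (A : Model r V) : Frame r V :=
  ⟨(e : _ →L[ℂ] V) ∘L ((ContinuousLinearMap.id ℂ (Fin r → ℂ)).prod A), by
    intro x y h
    simpa using congrArg Prod.fst (e.injective h)⟩

/-- The graph `{e (x, A x)}` of `A` in `V`. -/
def graph (e : Splitting r V) (A : Model r V) : Gr r V := ofFrame (graphFrame e A)

/-- First component of a linear map `ℂ^r → V` with respect to a splitting. -/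
def comp₁ (e : Splitting r V) (f : (Fin r → ℂ) →L[ℂ] V) : (Fin r → ℂ) →L[ℂ] (Fin r → ℂ) :=
  ContinuousLinearMap.fst ℂ _ _ ∘L
    (e.symm : V →L[ℂ] (Fin r → ℂ) × (Fin (Module.finrank ℂ V - r) → ℂ)) ∘L f

/-- Second component of a linear map `ℂ^r → V` with respect to a splitting. -/
def comp₂ (e : Splitting r V) (f : (Fin r → ℂ) →L[ℂ] V) : Model r V :=
  ContinuousLinearMap.snd ℂ _ _ ∘L
    (e.symm : V →L[ℂ] (Fin r → ℂ) × (Fin (Module.finrank ℂ V - r) → ℂ)) ∘L f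

/-- The matrix `f₂ f₁⁻¹` of inhomogeneous coordinates of a frame `f = (f₁, f₂)`. -/
def slope (e : Splitting r V) (f : (Fin r → ℂ) →L[ℂ] V) : Model r V :=
  comp₂ e f ∘L Ring.inverse (comp₁ e f)

lemma mem_ofFrame (f : Frame r V) (v : V) : v ∈ (ofFrame f).1 ↔ ∃ x, f.1 x = v := Iff.rfl

lemma mem_graph (e : Splitting r V) (A : Model r V) (v : V) :
    v ∈ (graph e A).1 ↔ (e.symm v).2 = A (e.symm v).1 := by
  constructor
  · rintro ⟨x, rfl⟩
    simp [graphFrame]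
  · intro h
    refine ⟨(e.symm v).1, ?_⟩
    change e ((e.symm v).1, A (e.symm v).1) = v
    rw [← h, Prod.mk.eta, e.apply_symm_apply]

lemma graph_injective (e : Splitting r V) : Function.Injective (graph e) := by
  intro A B h
  ext1 x
  have h1 : e (x, A x) ∈ (graph e A).1 := by rw [mem_graph]; simp
  rw [h, mem_graph] at h1
  simpa using h1

lemma ofFrame_eq_graph (e : Splitting r V) (f : Frame r V) (h : IsUnit (comp₁ e f.1)) :
    ofFrame f = graph e (slope e f.1) := by
  apply Subtype.ext
  ext v
  rw [mem_graph, mem_ofFrame]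
  have hl : ∀ x, Ring.inverse (comp₁ e f.1) (comp₁ e f.1 x) = x := fun x =>
    congrArg (fun T : (Fin r → ℂ) →L[ℂ] (Fin r → ℂ) => T x) (Ring.inverse_mul_cancel _ h)
  have hr : ∀ x, comp₁ e f.1 (Ring.inverse (comp₁ e f.1) x) = x := fun x =>
    congrArg (fun T : (Fin r → ℂ) →L[ℂ] (Fin r → ℂ) => T x) (Ring.mul_inverse_cancel _ h)
  constructor
  · rintro ⟨x, rfl⟩
    change comp₂ e f.1 x = comp₂ e f.1 (Ring.inverse (comp₁ e f.1) (comp₁ e f.1 x))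
    rw [hl]
  · intro hv
    refine ⟨Ring.inverse (comp₁ e f.1) (e.symm v).1, ?_⟩
    apply e.symm.injective
    refine Prod.ext (hr _) ?_
    rw [hv]
    rfl

lemma isUnit_comp₁ (e : Splitting r V) (f : Frame r V) (h : ofFrame f ∈ Set.range (graph e)) :
    IsUnit (comp₁ e f.1) := by
  obtain ⟨A, hA⟩ := h
  have hinj : Function.Injective (comp₁ e f.1) := by
    rw [injective_iff_map_eq_zero]
    intro x hx
    have hm : f.1 x ∈ (graph e A).1 := by rw [hA]; exact ⟨x, rfl⟩
    rw [mem_graph] at hm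
    have hx' : (e.symm (f.1 x)).1 = 0 := hx
    rw [hx', map_zero] at hm
    have h0 : e.symm (f.1 x) = 0 := Prod.ext hx' hm
    have h1 : f.1 x = 0 := by simpa using h0
    exact f.2 (by rw [h1, map_zero])
  let T : (Fin r → ℂ) ≃L[ℂ] (Fin r → ℂ) :=
    (LinearEquiv.ofInjectiveEndo (comp₁ e f.1 : (Fin r → ℂ) →ₗ[ℂ] (Fin r → ℂ))
      hinj).toContinuousLinearEquiv
  have hT : (T : (Fin r → ℂ) →L[ℂ] (Fin r → ℂ)) = comp₁ e f.1 := by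
    ext1 x; rfl
  rw [← hT]
  exact ⟨ContinuousLinearEquiv.toUnit T, rfl⟩

lemma ofFrame_mem_range_graph (e : Splitting r V) (f : Frame r V) :
    ofFrame f ∈ Set.range (graph e) ↔ IsUnit (comp₁ e f.1) :=
  ⟨isUnit_comp₁ e f, fun h => ⟨_, (ofFrame_eq_graph e f h).symm⟩⟩

lemma invFun_graph_ofFrame (e : Splitting r V) (f : Frame r V) (h : IsUnit (comp₁ e f.1)) :
    Function.invFun (graph e) (ofFrame f) = slope e f.1 := by
  rw [ofFrame_eq_graph e f h, Function.leftInverse_invFun (graph_injective e)]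

lemma contDiff_comp₁ (e : Splitting r V) : ContDiff ℂ ω (comp₁ e) := by
  unfold comp₁; fun_prop

lemma contDiff_comp₂ (e : Splitting r V) : ContDiff ℂ ω (comp₂ e) := by
  unfold comp₂; fun_prop

lemma contDiffAt_slope (e : Splitting r V) (f : (Fin r → ℂ) →L[ℂ] V) (h : IsUnit (comp₁ e f)) :
    ContDiffAt ℂ ω (slope e) f := by
  obtain ⟨u, hu⟩ := h
  have h1 : ContDiffAt ℂ ω (Ring.inverse : ((Fin r → ℂ) →L[ℂ] (Fin r → ℂ)) → _) (comp₁ e f) := by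
    rw [← hu]; exact contDiffAt_ringInverse ℂ u
  exact (contDiff_comp₂ e).contDiffAt.clm_comp (h1.comp f (contDiff_comp₁ e).contDiffAt)

lemma contDiff_graphFrame (e : Splitting r V) :
    ContDiff ℂ ω (fun A : Model r V => (graphFrame e A).1) := by
  have h : (fun A : Model r V => (graphFrame e A).1) = fun A =>
      (e : _ →L[ℂ] V) ∘L (ContinuousLinearMap.inl ℂ _ _ + ContinuousLinearMap.inr ℂ _ _ ∘L A) := by
    funext A
    ext1 x
    change e (x, A x) = e ((x, 0) + (0, A x))
    simp
  rw [h]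
  fun_prop

lemma continuous_ofFrame : Continuous (ofFrame : Frame r V → Gr r V) := continuous_coinduced_rng

variable [FiniteDimensional ℂ V]

lemma ofFrame_surjective : Function.Surjective (ofFrame : Frame r V → Gr r V) := by
  rintro ⟨W, hW⟩
  let b : (Fin r → ℂ) ≃ₗ[ℂ] W := LinearEquiv.ofFinrankEq _ _ (by rw [hW, Module.finrank_fin_fun])
  refine ⟨⟨LinearMap.toContinuousLinearMap (W.subtype ∘ₗ b.toLinearMap), ?_⟩, ?_⟩
  · exact W.injective_subtype.comp b.injective
  · apply Subtype.ext
    change LinearMap.range (W.subtype ∘ₗ b.toLinearMap) = W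
    rw [LinearMap.range_comp, LinearEquiv.range, Submodule.map_top, Submodule.range_subtype]

lemma isQuotientMap_ofFrame : Topology.IsQuotientMap (ofFrame : Frame r V → Gr r V) :=
  ⟨⟨rfl⟩, ofFrame_surjective⟩

lemma isOpen_range_graph (e : Splitting r V) : IsOpen (Set.range (graph e)) := by
  rw [← isQuotientMap_ofFrame.isOpen_preimage]
  have h : ofFrame ⁻¹' Set.range (graph e) =
      (fun f : Frame r V => comp₁ e f.1) ⁻¹' {T | IsUnit T} := by
    ext f; exact ofFrame_mem_range_graph e f
  rw [h]
  exact Units.isOpen.preimage ((contDiff_comp₁ e).continuous.comp continuous_subtype_val)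

/-- The standard chart attached to a splitting `ℂ^r × ℂ^(n-r) ≃ V`: it sends the graph of
`A : ℂ^r → ℂ^(n-r)` to `A`. -/
def chart (e : Splitting r V) : OpenPartialHomeomorph (Gr r V) (Model r V) where
  toFun := Function.invFun (graph e)
  invFun := graph e
  source := Set.range (graph e)
  target := Set.univ
  map_source' _ _ := Set.mem_univ _
  map_target' A _ := ⟨A, rfl⟩
  left_inv' _ h := Function.invFun_eq h
  right_inv' A _ := Function.leftInverse_invFun (graph_injective e) A
  open_source := isOpen_range_graph e
  open_target := isOpen_univ
  continuousOn_toFun := by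
    rw [isQuotientMap_ofFrame.continuousOn_isOpen_iff (isOpen_range_graph e)]
    intro f hf
    have hu := (ofFrame_mem_range_graph e f).1 hf
    have h1 : ContinuousAt (fun f : Frame r V => slope e f.1) f :=
      ContinuousAt.comp (f := Subtype.val) (g := slope e) (contDiffAt_slope e f.1 hu).continuousAt
        continuous_subtype_val.continuousAt
    refine h1.continuousWithinAt.congr (fun g hg => ?_) ?_
    · exact invFun_graph_ofFrame e g ((ofFrame_mem_range_graph e g).1 hg)
    · exact invFun_graph_ofFrame e f hu
  continuousOn_invFun := by
    refine (continuous_ofFrame.comp ?_).continuousOn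
    exact Continuous.subtype_mk (contDiff_graphFrame e).continuous _

lemma exists_splitting (W : Gr r V) : ∃ e : Splitting r V, W ∈ (chart e).source := by
  obtain ⟨C, hC⟩ := W.1.exists_isCompl
  have hd := Submodule.finrank_add_eq_of_isCompl hC
  have hW : Module.finrank ℂ W.1 = r := W.2
  let a : (Fin r → ℂ) ≃ₗ[ℂ] W.1 :=
    LinearEquiv.ofFinrankEq _ _ (by rw [hW, Module.finrank_fin_fun])
  let b : (Fin (Module.finrank ℂ V - r) → ℂ) ≃ₗ[ℂ] C :=
    LinearEquiv.ofFinrankEq _ _ (by rw [Module.finrank_fin_fun]; omega)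
  let e : Splitting r V :=
    ((a.prodCongr b).trans (Submodule.prodEquivOfIsCompl W.1 C hC)).toContinuousLinearEquiv
  refine ⟨e, 0, ?_⟩
  have he : ∀ x, e (x, 0) = (a x : V) := by
    intro x
    change ((a x : V) + ((b 0 : C) : V)) = _
    simp
  apply Subtype.ext
  ext v
  constructor
  · rintro ⟨x, rfl⟩
    change e (x, 0) ∈ W.1
    rw [he]
    exact (a x).2
  · intro hv
    refine ⟨a.symm ⟨v, hv⟩, ?_⟩
    change e (a.symm ⟨v, hv⟩, 0) = v
    rw [he]; simp

/-- The atlas of all standard charts. -/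
instance : ChartedSpace (Model r V) (Gr r V) where
  atlas := Set.range chart
  chartAt W := chart (exists_splitting W).choose
  mem_chart_source W := (exists_splitting W).choose_spec
  chart_mem_atlas _ := ⟨_, rfl⟩

/-- The Grassmannian is a complex (analytic) manifold. -/
instance : IsManifold 𝓘(ℂ, Model r V) ω (Gr r V) := by
  apply isManifold_of_contDiffOn
  rintro _ _ ⟨e, rfl⟩ ⟨e', rfl⟩
  have key : ∀ A : Model r V, graph e A ∈ Set.range (graph e') →
      IsUnit (comp₁ e' (graphFrame e A).1) :=
    fun A hA => (ofFrame_mem_range_graph e' (graphFrame e A)).1 hA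
  intro A hA
  have hA' : graph e A ∈ Set.range (graph e') := by
    have := hA.1
    simp only [Set.mem_preimage, OpenPartialHomeomorph.trans_source] at this
    exact this.2
  have h1 : ContDiffAt ℂ ω (fun A : Model r V => slope e' (graphFrame e A).1) A :=
    ContDiffAt.comp (g := slope e') A (contDiffAt_slope e' _ (key A hA')) (contDiff_graphFrame e).contDiffAt
  refine h1.contDiffWithinAt.congr (fun B hB => ?_) ?_
  · have hB' : graph e B ∈ Set.range (graph e') := by
      have := hB.1
      simp only [Set.mem_preimage, OpenPartialHomeomorph.trans_source] at this
      exact this.2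
    exact invFun_graph_ofFrame e' (graphFrame e B) (key B hB')
  · exact invFun_graph_ofFrame e' (graphFrame e A) (key A hA')

end Gr

/-- A map `F` between Grassmannians is holomorphic on `U` (used for open `U`): it is continuous
and complex differentiable when read in the standard charts. -/
def HolomorphicOn {r : ℕ} {V : Type*} [NormedAddCommGroup V] [NormedSpace ℂ V]
    [FiniteDimensional ℂ V] (F : Gr r V → Gr r V) (U : Set (Gr r V)) : Prop :=
  MDifferentiableOn 𝓘(ℂ, Gr.Model r V) 𝓘(ℂ, Gr.Model r V) F U

end Grassmannian

/-! ### Generalized type-I domains and their linear self maps -/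

/-- The coordinate space `ℂ^(p+q)`, the first `p` coordinates being indexed by `Fin p` and the
last `q` by `Fin q`. -/
abbrev Cpq (p q : ℕ) : Type := Fin p ⊕ Fin q → ℂ

/-- The matrix `H_{p,q} = diag(I_p, -I_q)`. -/
def Hpq (p q : ℕ) : Matrix (Fin p ⊕ Fin q) (Fin p ⊕ Fin q) ℂ := Matrix.fromBlocks 1 0 0 (-1)

/-- The (real) value `v^H H_{p,q} v` of the Hermitian form of signature `(p,q)`. -/
def hermForm (p q : ℕ) (v : Cpq p q) : ℝ := (star v ⬝ᵥ (Hpq p q).mulVec v).re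

/-- The generalized type-I domain `D^r_{p,q}`: the `r`-planes in `ℂ^(p+q)` on which `H_{p,q}` is
positive definite. -/
def typeIDomain (r p q : ℕ) : Set (Gr r (Cpq p q)) :=
  {W | ∀ v ∈ W.1, v ≠ 0 → 0 < hermForm p q v}

/-- `M` is a matrix representation of the self map `f` of `D^r_{p,q}`: `f W` is the image of `W`
under `z ↦ M z`. -/
def IsMatrixRep {r p q : ℕ} (M : Matrix (Fin p ⊕ Fin q) (Fin p ⊕ Fin q) ℂ)
    (f : typeIDomain r p q → typeIDomain r p q) : Prop :=
  ∀ W, (f W).1.1 = W.1.1.map M.mulVecLin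

/-- `f` is a linear self map of `D^r_{p,q}`. -/
def IsLinearSelfMap {r p q : ℕ} (f : typeIDomain r p q → typeIDomain r p q) : Prop :=
  ∃ M, IsMatrixRep M f

/-- `f` is minimal: it is given by a matrix of rank `p`. -/
def IsMinimalSelfMap {r p q : ℕ} (f : typeIDomain r p q → typeIDomain r p q) : Prop :=
  ∃ M, IsMatrixRep M f ∧ M.rank = p

end

/-!
Let `M` represent `f` and write `h` for the Hermitian form. Every `h`-positive vector lies in an
`h`-positive `r`-plane, so `M` maps positive vectors to positive vectors; in particular `M` is
injective on the positive `p`-plane `ℂ^p × 0`, and `p ≤ rank M`.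

Suppose that `ker M` contains a nonzero null vector `v`. If `w` pairs positively with `v`, then
`v + ε w` is positive for small `ε > 0`, so its image `ε M w` is positive. As the vectors `w` which
pair nontrivially with `v` are dense, `h ≥ 0` on the range of `M`
(`hermForm_mulVec_nonneg_of_null_mem_ker`), and a subspace on which `h ≥ 0` has dimension at most
`p`. Hence `rank M = p` and `f` is minimal.

So for non-minimal `f` the kernel of `M` contains no nonzero vector with `h ≥ 0`. Planes in the
closure of the domain satisfy `h ≥ 0`, so they all lie in the open set of planes on which `M` is
injective, and there `W ↦ M W` is holomorphic (`holomorphicOn_mapPlane`): in standard charts it is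
the slope of the frame `M ∘ (e (x, A x))`, an analytic function of `A`.
-/

noncomputable section

/-! ### The map of Grassmannians induced by a linear map -/

namespace Gr

variable {r : ℕ} {V : Type*} [NormedAddCommGroup V] [NormedSpace ℂ V]

/-- The planes on which the linear map `T` is injective. -/
def injLocus (r : ℕ) (T : V →L[ℂ] V) : Set (Gr r V) :=
  {W | ∀ v ∈ W.1, T v = 0 → v = 0}

open Classical in
/-- The image of a plane under `T`. Planes whose image has smaller dimension are left in place;
this junk value only occurs outside `injLocus r T`. -/
def mapPlane (T : V →L[ℂ] V) (W : Gr r V) : Gr r V :=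
  if h : Module.finrank ℂ (W.1.map (T : V →ₗ[ℂ] V)) = r then ⟨W.1.map (T : V →ₗ[ℂ] V), h⟩ else W

lemma mapPlane_val (T : V →L[ℂ] V) (W : Gr r V)
    (h : Module.finrank ℂ (W.1.map (T : V →ₗ[ℂ] V)) = r) :
    (mapPlane T W).1 = W.1.map (T : V →ₗ[ℂ] V) := by
  unfold mapPlane
  exact congrArg Subtype.val (dif_pos h)

lemma ofFrame_mem_injLocus (T : V →L[ℂ] V) (f : Frame r V) :
    ofFrame f ∈ injLocus r T ↔ Function.Injective (T ∘L f.1) := by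
  rw [injective_iff_map_eq_zero]
  constructor
  · intro h x hx
    exact f.2 ((h (f.1 x) ⟨x, rfl⟩ hx).trans (map_zero f.1).symm)
  · rintro h _ ⟨x, rfl⟩ hx
    have h0 : x = 0 := h x hx
    rw [h0, map_zero]

lemma mapPlane_ofFrame (T : V →L[ℂ] V) (f : Frame r V) (h : Function.Injective (T ∘L f.1)) :
    mapPlane T (ofFrame f) = ofFrame ⟨T ∘L f.1, h⟩ := by
  have hmap : (ofFrame f).1.map (T : V →ₗ[ℂ] V) = (ofFrame ⟨T ∘L f.1, h⟩).1 :=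
    (LinearMap.range_comp (f.1 : (Fin r → ℂ) →ₗ[ℂ] V) (T : V →ₗ[ℂ] V)).symm
  apply Subtype.ext
  rw [mapPlane_val T _ (by rw [hmap]; exact (ofFrame ⟨T ∘L f.1, h⟩).2), hmap]

variable [FiniteDimensional ℂ V]

lemma isOpen_injLocus (T : V →L[ℂ] V) : IsOpen (injLocus r T) := by
  rw [← isQuotientMap_ofFrame.isOpen_preimage]
  have h : ofFrame ⁻¹' injLocus r T =
      (fun f : Frame r V => T ∘L f.1) ⁻¹' {g | Function.Injective g} := by
    ext f; exact ofFrame_mem_injLocus T f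
  rw [h]
  refine ContinuousLinearMap.isOpen_injective.preimage ?_
  have h1 : Continuous fun f : (Fin r → ℂ) →L[ℂ] V => T ∘L f := by fun_prop
  exact h1.comp continuous_subtype_val

/-- Near a plane `W` on which `T` is injective, `mapPlane T` is the composition of a chart at `W`,
the analytic map `A ↦ slope e' (T ∘ graphFrame e A)` and an inverse chart at `mapPlane T W`. -/
lemma holomorphicOn_mapPlane (T : V →L[ℂ] V) :
    HolomorphicOn (mapPlane T) (injLocus r T) := by
  intro W hW
  apply MDifferentiableAt.mdifferentiableWithinAt
  obtain ⟨e, he⟩ := exists_splitting W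
  obtain ⟨e', he'⟩ := exists_splitting (mapPlane T W)
  set A := chart e W
  have hWA : graph e A = W := (chart e).left_inv he
  have hinj : Function.Injective (T ∘L (graphFrame e A).1) := by
    rw [← ofFrame_mem_injLocus]
    change graph e A ∈ _
    rwa [hWA]
  have hFW : mapPlane T W = ofFrame ⟨T ∘L (graphFrame e A).1, hinj⟩ := by
    rw [← hWA]; exact mapPlane_ofFrame T (graphFrame e A) hinj
  have hunit : IsUnit (comp₁ e' (T ∘L (graphFrame e A).1)) := by
    rw [hFW] at he'
    exact isUnit_comp₁ e' _ he'
  have hframe : ContDiff ℂ ω (fun B : Model r V => T ∘L (graphFrame e B).1) := by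
    have := contDiff_graphFrame e
    fun_prop
  -- The map read in the charts `e` and `e'`.
  let s : Model r V → Model r V := fun B => slope e' (T ∘L (graphFrame e B).1)
  have hs : MDifferentiableAt 𝓘(ℂ, Model r V) 𝓘(ℂ, Model r V) s A := by
    have h1 : ContDiffAt ℂ ω s A :=
      ContDiffAt.comp (g := slope e') A (contDiffAt_slope e' _ hunit) hframe.contDiffAt
    exact (h1.differentiableAt (by simp)).mdifferentiableAt
  have hchart : MDifferentiableAt 𝓘(ℂ, Model r V) 𝓘(ℂ, Model r V) (chart e) W :=
    mdifferentiableAt_atlas (⟨e, rfl⟩ : chart e ∈ atlas (Model r V) (Gr r V)) he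
  have hsymm : MDifferentiableAt 𝓘(ℂ, Model r V) 𝓘(ℂ, Model r V) (chart e').symm (s A) :=
    mdifferentiableAt_atlas_symm (⟨e', rfl⟩ : chart e' ∈ atlas (Model r V) (Gr r V))
      (Set.mem_univ _)
  refine ((hsymm.comp A hs).comp W hchart).congr_of_eventuallyEq ?_
  have hopen : ∀ᶠ B in nhds A, IsUnit (comp₁ e' (T ∘L (graphFrame e B).1)) :=
    (((contDiff_comp₁ e').continuous.comp hframe.continuous).continuousAt).eventually
      (Units.isOpen.mem_nhds hunit)
  filter_upwards [(chart e).open_source.mem_nhds he, (isOpen_injLocus T).mem_nhds hW,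
    hchart.continuousAt.eventually hopen] with X hX hXT hXu
  have hXA : graph e (chart e X) = X := (chart e).left_inv hX
  have hXinj : Function.Injective (T ∘L (graphFrame e (chart e X)).1) := by
    rw [← ofFrame_mem_injLocus]
    change graph e (chart e X) ∈ _
    rwa [hXA]
  have h1 : mapPlane T X = ofFrame ⟨T ∘L (graphFrame e (chart e X)).1, hXinj⟩ := by
    conv_lhs => rw [← hXA]
    exact mapPlane_ofFrame T (graphFrame e (chart e X)) hXinj
  exact h1.trans (ofFrame_eq_graph e' ⟨_, hXinj⟩ hXu)

end Gr

/-! ### The Hermitian form -/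

section HermForm

variable {p q : ℕ}

lemma hermForm_eq (v : Cpq p q) :
    hermForm p q v =
      ∑ i, Complex.normSq (v (Sum.inl i)) - ∑ j, Complex.normSq (v (Sum.inr j)) := by
  simp [hermForm, Hpq, Matrix.fromBlocks_mulVec, dotProduct, Fintype.sum_sum_type,
    Complex.normSq_apply, Matrix.neg_mulVec, sub_eq_add_neg]

lemma continuous_hermForm : Continuous (hermForm p q) := by
  have h : hermForm p q = fun v => _ := funext hermForm_eq
  rw [h]
  have := Complex.continuous_normSq
  fun_prop

lemma hermForm_smul (c : ℝ) (v : Cpq p q) : hermForm p q (c • v) = c ^ 2 * hermForm p q v := by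
  simp only [hermForm_eq, Pi.smul_apply, Complex.normSq_apply, Complex.smul_re, Complex.smul_im,
    smul_eq_mul, mul_sub, Finset.mul_sum]
  congr 1 <;> exact Finset.sum_congr rfl fun i _ => by ring

/-- The real part of the sesquilinear form whose quadratic form is `hermForm`. -/
def hermPair (v w : Cpq p q) : ℝ :=
  ∑ i, ((v (Sum.inl i)).re * (w (Sum.inl i)).re + (v (Sum.inl i)).im * (w (Sum.inl i)).im) -
    ∑ j, ((v (Sum.inr j)).re * (w (Sum.inr j)).re + (v (Sum.inr j)).im * (w (Sum.inr j)).im)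

lemma hermForm_add (v w : Cpq p q) :
    hermForm p q (v + w) = hermForm p q v + 2 * hermPair v w + hermForm p q w := by
  simp only [hermForm_eq, hermPair, Pi.add_apply, Complex.normSq_apply, Complex.add_re,
    Complex.add_im, mul_sub, Finset.mul_sum]
  have key : ∀ {ι : Type} [Fintype ι] (a b : ι → ℂ),
      ∑ i, (((a i).re + (b i).re) * ((a i).re + (b i).re) +
        ((a i).im + (b i).im) * ((a i).im + (b i).im)) =
      ∑ i, ((a i).re * (a i).re + (a i).im * (a i).im) +
        ∑ i, 2 * ((a i).re * (b i).re + (a i).im * (b i).im) +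
        ∑ i, ((b i).re * (b i).re + (b i).im * (b i).im) := by
    intro ι _ a b
    rw [← Finset.sum_add_distrib, ← Finset.sum_add_distrib]
    exact Finset.sum_congr rfl fun i _ => by ring
  rw [key (fun i => v (Sum.inl i)) fun i => w (Sum.inl i),
    key (fun i => v (Sum.inr i)) fun i => w (Sum.inr i)]
  ring

lemma hermPair_add_right (v w u : Cpq p q) :
    hermPair v (w + u) = hermPair v w + hermPair v u := by
  simp only [hermPair, Pi.add_apply, Complex.add_re, Complex.add_im, mul_add,
    Finset.sum_add_distrib]
  ring

lemma hermPair_smul_right (c : ℝ) (v w : Cpq p q) : hermPair v (c • w) = c * hermPair v w := by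
  simp only [hermPair, Pi.smul_apply, Complex.smul_re, Complex.smul_im, smul_eq_mul, mul_sub,
    Finset.mul_sum]
  congr 1 <;> exact Finset.sum_congr rfl fun i _ => by ring

/-- The Hermitian form is nondegenerate: `H_{p,q} v` pairs positively with `v`. -/
lemma exists_hermPair_pos {v : Cpq p q} (hv : v ≠ 0) : ∃ u, 0 < hermPair v u := by
  refine ⟨Sum.elim (fun i => v (Sum.inl i)) (fun j => -v (Sum.inr j)), ?_⟩
  have h : hermPair v (Sum.elim (fun i => v (Sum.inl i)) (fun j => -v (Sum.inr j))) =
      ∑ k, Complex.normSq (v k) := by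
    simp [hermPair, Fintype.sum_sum_type, Complex.normSq_apply, Finset.sum_add_distrib]
    ring
  rw [h]
  obtain ⟨k, hk⟩ := Function.ne_iff.1 hv
  exact Finset.sum_pos' (fun i _ => Complex.normSq_nonneg _)
    ⟨k, Finset.mem_univ _, Complex.normSq_pos.2 hk⟩

/-- A null vector becomes positive when moved slightly in a direction pairing positively with
it. -/
lemma exists_hermForm_add_smul_pos {v w : Cpq p q} (hv : hermForm p q v = 0)
    (hw : 0 < hermPair v w) : ∃ ε : ℝ, 0 < ε ∧ 0 < hermForm p q (v + ε • w) := by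
  have hd : 0 < |hermForm p q w| + 1 := by positivity
  refine ⟨hermPair v w / (|hermForm p q w| + 1), by positivity, ?_⟩
  set ε := hermPair v w / (|hermForm p q w| + 1) with hε
  have hε0 : 0 < ε := by positivity
  have h1 : ε * (|hermForm p q w| + 1) = hermPair v w := by rw [hε]; field_simp
  rw [hermForm_add, hermPair_smul_right, hermForm_smul, hv]
  have h2 : -|hermForm p q w| ≤ hermForm p q w := neg_abs_le _
  have h3 : 0 < 2 * hermPair v w + ε * hermForm p q w := by nlinarith
  nlinarith [mul_pos hε0 h3]

/-- A subspace on which the form is positive semidefinite has dimension at most `p`, because it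
projects injectively to the first `p` coordinates. -/
lemma finrank_le_of_hermForm_nonneg (S : Submodule ℂ (Cpq p q))
    (hS : ∀ v ∈ S, 0 ≤ hermForm p q v) : Module.finrank ℂ S ≤ p := by
  let π : S →ₗ[ℂ] (Fin p → ℂ) := (LinearMap.funLeft ℂ ℂ Sum.inl) ∘ₗ S.subtype
  have hπ : Function.Injective π := by
    rw [injective_iff_map_eq_zero]
    rintro ⟨v, hvS⟩ hv
    have h1 : ∀ i, v (Sum.inl i) = 0 := fun i => congrFun hv i
    have h2 := hS v hvS
    rw [hermForm_eq] at h2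
    simp only [h1, map_zero, Finset.sum_const_zero, zero_sub, Left.nonneg_neg_iff] at h2
    have h3 := (Finset.sum_eq_zero_iff_of_nonneg fun j _ => Complex.normSq_nonneg _).1
      (le_antisymm h2 (Finset.sum_nonneg fun j _ => Complex.normSq_nonneg _))
    ext k
    rcases k with i | j
    · exact h1 i
    · exact Complex.normSq_eq_zero.1 (h3 j (Finset.mem_univ _))
  simpa using LinearMap.finrank_le_finrank_of_injective hπ

/-- For `v = (a, b)`, the linear map `x ↦ (x, (⟨a, x⟩ / ‖a‖²) b)`. If `v` is positive, that is, if
`‖b‖ < ‖a‖`, its range is a positive `p`-plane containing `v`. -/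
def positiveFrame (v : Cpq p q) : (Fin p → ℂ) →ₗ[ℂ] Cpq p q where
  toFun x := Sum.elim x fun j =>
    (∑ i, star (v (Sum.inl i)) * x i) / ((∑ i, Complex.normSq (v (Sum.inl i)) : ℝ) : ℂ) *
      v (Sum.inr j)
  map_add' x y := by
    ext (i | j)
    · simp
    · simp only [Sum.elim_inr, Pi.add_apply, mul_add, Finset.sum_add_distrib]
      ring
  map_smul' c x := by
    ext (i | j)
    · simp
    · simp only [Sum.elim_inr, Pi.smul_apply, smul_eq_mul, RingHom.id_apply,
        mul_left_comm _ c, ← Finset.mul_sum]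
      ring

lemma positiveFrame_injective (v : Cpq p q) : Function.Injective (positiveFrame v) := by
  intro x y h
  ext i
  exact congrFun h (Sum.inl i)

/-- The Cauchy–Schwarz inequality in coordinates. -/
lemma normSq_sum_star_mul_le (a x : Fin p → ℂ) :
    Complex.normSq (∑ i, star (a i) * x i) ≤
      (∑ i, Complex.normSq (a i)) * ∑ i, Complex.normSq (x i) := by
  have h := norm_inner_le_norm (𝕜 := ℂ) (WithLp.toLp 2 a) (WithLp.toLp 2 x)
  have h2 := mul_self_le_mul_self (norm_nonneg _) h
  have hinner : inner ℂ (WithLp.toLp 2 a) (WithLp.toLp 2 x) = ∑ i, star (a i) * x i := by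
    simp [PiLp.inner_apply, mul_comm]
  rw [mul_mul_mul_comm, ← sq, ← sq, ← sq, EuclideanSpace.norm_sq_eq,
    EuclideanSpace.norm_sq_eq, hinner] at h2
  simpa only [Complex.normSq_eq_norm_sq] using h2

lemma hermForm_positiveFrame_pos {v : Cpq p q} (hv : 0 < hermForm p q v) {x : Fin p → ℂ}
    (hx : x ≠ 0) : 0 < hermForm p q (positiveFrame v x) := by
  have hCS := normSq_sum_star_mul_le (fun i => v (Sum.inl i)) x
  rw [hermForm_eq] at hv ⊢
  simp only [positiveFrame, LinearMap.coe_mk, AddHom.coe_mk, Sum.elim_inl, Sum.elim_inr, map_mul,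
    map_div₀, Complex.normSq_ofReal, ← Finset.mul_sum]
  set s := ∑ i, Complex.normSq (v (Sum.inl i))
  set t := ∑ j, Complex.normSq (v (Sum.inr j))
  set X := ∑ i, Complex.normSq (x i)
  set N := Complex.normSq (∑ i, star (v (Sum.inl i)) * x i)
  have ht : 0 ≤ t := Finset.sum_nonneg fun j _ => Complex.normSq_nonneg _
  have hs : 0 < s := by linarith
  have hXpos : 0 < X := by
    obtain ⟨k, hk⟩ := Function.ne_iff.1 hx
    exact Finset.sum_pos' (fun i _ => Complex.normSq_nonneg _)
      ⟨k, Finset.mem_univ _, Complex.normSq_pos.2 hk⟩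
  rw [sub_pos, div_mul_eq_mul_div, div_lt_iff₀ (by positivity)]
  calc N * t ≤ s * X * t := mul_le_mul_of_nonneg_right hCS ht
    _ < s * X * s := mul_lt_mul_of_pos_left (by linarith) (by positivity)
    _ = X * (s * s) := by ring

lemma positiveFrame_apply_inl {v : Cpq p q} (hv : 0 < hermForm p q v) :
    positiveFrame v (fun i => v (Sum.inl i)) = v := by
  rw [hermForm_eq] at hv
  have ht : 0 ≤ ∑ j, Complex.normSq (v (Sum.inr j)) :=
    Finset.sum_nonneg fun j _ => Complex.normSq_nonneg _
  have hs : ((∑ i, Complex.normSq (v (Sum.inl i)) : ℝ) : ℂ) ≠ 0 := by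
    rw [Complex.ofReal_ne_zero]; linarith
  ext (i | j)
  · rfl
  · have h : ∑ i, star (v (Sum.inl i)) * v (Sum.inl i) =
        ((∑ i, Complex.normSq (v (Sum.inl i)) : ℝ) : ℂ) := by
      rw [Complex.ofReal_sum]
      exact Finset.sum_congr rfl fun i _ => (Complex.normSq_eq_conj_mul_self).symm
    change (∑ i, star (v (Sum.inl i)) * v (Sum.inl i)) / _ * v (Sum.inr j) = _
    rw [h, div_self hs, one_mul]

lemma exists_submodule_mem_finrank_eq {K V : Type*} [Field K] [AddCommGroup V] [Module K V]
    {x : V} (hx : x ≠ 0) {r : ℕ} (hr : 0 < r) (hrV : r ≤ Module.finrank K V) :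
    ∃ S : Submodule K V, x ∈ S ∧ Module.finrank K S = r := by
  suffices h : ∃ b : Fin r → V, LinearIndependent K b ∧ x ∈ Set.range b by
    obtain ⟨b, hb, hxb⟩ := h
    exact ⟨Submodule.span K (Set.range b), Submodule.subset_span hxb,
      by rw [finrank_span_eq_card hb, Fintype.card_fin]⟩
  induction r, hr using Nat.le_induction with
  | base => exact ⟨fun _ => x, LinearIndependent.of_subsingleton 0 hx, 0, rfl⟩
  | succ n _ ih =>
    obtain ⟨b, hb, i, hi⟩ := ih (by omega)
    obtain ⟨y, hy⟩ := exists_linearIndependent_snoc_of_lt_finrank hb (by omega)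
    exact ⟨_, hy, i.castSucc, by simpa using hi⟩

/-- Every positive vector lies in a positive `r`-plane, if `1 ≤ r ≤ p`. -/
lemma exists_mem_typeIDomain {r : ℕ} (hr : 0 < r) (hrp : r ≤ p) {v : Cpq p q}
    (hv : 0 < hermForm p q v) : ∃ W ∈ typeIDomain r p q, v ∈ W.1 := by
  have hx : (fun i => v (Sum.inl i)) ≠ 0 := by
    intro h0
    have h1 := positiveFrame_apply_inl hv
    rw [h0, map_zero] at h1
    simp [← h1, hermForm] at hv
  obtain ⟨S, hxS, hSr⟩ := exists_submodule_mem_finrank_eq (K := ℂ) hx hr (by simpa using hrp)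
  have hWr : Module.finrank ℂ (S.map (positiveFrame v)) = r := by
    rw [← (Submodule.equivMapOfInjective _ (positiveFrame_injective v) S).finrank_eq, hSr]
  refine ⟨⟨S.map (positiveFrame v), hWr⟩, ?_, _, hxS, positiveFrame_apply_inl hv⟩
  rintro _ ⟨x, -, rfl⟩ hw0
  exact hermForm_positiveFrame_pos hv fun h => hw0 (by rw [h, map_zero])

/-- Planes in the closure of the domain are positive semidefinite. -/
lemma hermForm_nonneg_of_mem_closure {r : ℕ} {W : Gr r (Cpq p q)}
    (hW : W ∈ closure (typeIDomain r p q)) : ∀ v ∈ W.1, 0 ≤ hermForm p q v := by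
  have hclosed : IsClosed {W : Gr r (Cpq p q) | ∀ v ∈ W.1, 0 ≤ hermForm p q v} := by
    rw [← Gr.isQuotientMap_ofFrame.isClosed_preimage]
    have h : Gr.ofFrame ⁻¹' {W : Gr r (Cpq p q) | ∀ v ∈ W.1, 0 ≤ hermForm p q v} =
        ⋂ x : Fin r → ℂ, {f : Gr.Frame r (Cpq p q) | 0 ≤ hermForm p q (f.1 x)} := by
      ext f
      simp [Gr.mem_ofFrame]
    rw [h]
    refine isClosed_iInter fun x => isClosed_le continuous_const (continuous_hermForm.comp ?_)
    exact (ContinuousLinearMap.apply ℂ _ x).continuous.comp continuous_subtype_val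
  refine closure_minimal (fun W hW v hv => ?_) hclosed hW
  by_cases h0 : v = 0
  · simp [h0, hermForm]
  · exact (hW v hv h0).le

end HermForm

/-! ### Matrices preserving positivity -/

section PositiveMatrix

variable {p q : ℕ} {M : Matrix (Fin p ⊕ Fin q) (Fin p ⊕ Fin q) ℂ}

lemma le_rank_of_hermForm_pos (hM : ∀ v, 0 < hermForm p q v → 0 < hermForm p q (M.mulVec v)) :
    p ≤ M.rank := by
  -- This is the inclusion `x ↦ (x, 0)`.
  let ι : (Fin p → ℂ) →ₗ[ℂ] Cpq p q := positiveFrame 0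
  have hinj : Function.Injective (M.mulVecLin ∘ₗ ι) := by
    rw [injective_iff_map_eq_zero]
    intro x hx
    by_contra h0
    have hpos : 0 < hermForm p q (ι x) := by
      obtain ⟨k, hk⟩ := Function.ne_iff.1 h0
      rw [hermForm_eq]
      simpa [ι, positiveFrame] using Finset.sum_pos' (fun i _ => Complex.normSq_nonneg (x i))
        ⟨k, Finset.mem_univ _, Complex.normSq_pos.2 hk⟩
    have h1 := hM _ hpos
    have h2 : M.mulVec (ι x) = 0 := hx
    simp [h2, hermForm] at h1
  have h1 := LinearMap.finrank_range_of_inj hinj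
  rw [Module.finrank_fin_fun] at h1
  rw [Matrix.rank]
  conv_lhs => rw [← h1]
  exact Submodule.finrank_mono (LinearMap.range_comp_le_range _ _)

/-- If a matrix preserving positive vectors kills a nonzero null vector, its range is positive
semidefinite. -/
lemma hermForm_mulVec_nonneg_of_null_mem_ker
    (hM : ∀ v, 0 < hermForm p q v → 0 < hermForm p q (M.mulVec v)) {v : Cpq p q} (hv0 : v ≠ 0)
    (hv : hermForm p q v = 0) (hMv : M.mulVec v = 0) (w : Cpq p q) :
    0 ≤ hermForm p q (M.mulVec w) := by
  have hpos : ∀ w, 0 < hermPair v w → 0 < hermForm p q (M.mulVec w) := by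
    intro w hw
    obtain ⟨ε, hε, h⟩ := exists_hermForm_add_smul_pos hv hw
    have h1 := hM _ h
    rw [Matrix.mulVec_add, hMv, zero_add, Matrix.mulVec_smul, hermForm_smul] at h1
    exact pos_of_mul_pos_right h1 (sq_nonneg ε)
  obtain ⟨u, hu⟩ := exists_hermPair_pos hv0
  -- Approximate `w` by the vectors `w + δ u` with `δ → 0⁺`.
  have hnonneg : ∀ w, 0 ≤ hermPair v w → 0 ≤ hermForm p q (M.mulVec w) := by
    intro w hw
    have hcont : Continuous fun δ : ℝ => hermForm p q (M.mulVec (w + δ • u)) := by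
      refine continuous_hermForm.comp ?_
      exact (continuous_const.matrix_mulVec (by fun_prop))
    have hlim := (hcont.tendsto 0).mono_left (nhdsWithin_le_nhds (s := Set.Ioi 0))
    rw [zero_smul, add_zero] at hlim
    refine ge_of_tendsto hlim (Filter.eventually_of_mem self_mem_nhdsWithin fun δ hδ => ?_)
    refine (hpos _ ?_).le
    rw [hermPair_add_right, hermPair_smul_right]
    have := mul_pos (Set.mem_Ioi.1 hδ) hu
    linarith
  rcases le_total 0 (hermPair v w) with hw | hw
  · exact hnonneg w hw
  · have h := hnonneg ((-1 : ℝ) • w) (by rw [hermPair_smul_right]; linarith)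
    rw [Matrix.mulVec_smul, hermForm_smul] at h
    linarith

lemma rank_eq_of_null_mem_ker
    (hM : ∀ v, 0 < hermForm p q v → 0 < hermForm p q (M.mulVec v)) {v : Cpq p q} (hv0 : v ≠ 0)
    (hv : hermForm p q v = 0) (hMv : M.mulVec v = 0) : M.rank = p := by
  refine le_antisymm (finrank_le_of_hermForm_nonneg _ ?_) (le_rank_of_hermForm_pos hM)
  rintro _ ⟨w, rfl⟩
  exact hermForm_mulVec_nonneg_of_null_mem_ker hM hv0 hv hMv w

/-- A matrix representing a self map of the domain preserves positive vectors. -/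
lemma IsMatrixRep.hermForm_mulVec_pos {r : ℕ} (hr : 0 < r) (hrp : r ≤ p)
    {f : typeIDomain r p q → typeIDomain r p q} (hf : IsMatrixRep M f) (v : Cpq p q)
    (hv : 0 < hermForm p q v) : 0 < hermForm p q (M.mulVec v) := by
  obtain ⟨W, hW, hvW⟩ := exists_mem_typeIDomain hr hrp hv
  have himg := hf ⟨W, hW⟩
  refine (f ⟨W, hW⟩).2 _ (by rw [himg]; exact ⟨v, hvW, rfl⟩) fun h0 => ?_
  -- `M` is injective on `W`, since the image is again an `r`-plane.
  have hrk : Module.finrank ℂ (W.1.map M.mulVecLin) = Module.finrank ℂ W.1 := by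
    rw [← himg, W.2]; exact (f ⟨W, hW⟩).1.2
  have hsum := LinearMap.finrank_range_add_finrank_ker (M.mulVecLin.domRestrict W.1)
  rw [LinearMap.range_domRestrict, hrk, Nat.add_eq_left, Submodule.finrank_eq_zero] at hsum
  have hmem : (⟨v, hvW⟩ : W.1) ∈ LinearMap.ker (M.mulVecLin.domRestrict W.1) := h0
  rw [hsum, Submodule.mem_bot] at hmem
  have hv0 : v = 0 := congrArg Subtype.val hmem
  simp [hv0, hermForm] at hv

end PositiveMatrix

end

theorem theorem2p5 (p q r : ℕ) (hp : 0 < p) (hq : 0 < q) (hr : 0 < r) (hrp : r ≤ p)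
    (f : typeIDomain r p q → typeIDomain r p q)
    (hf : IsLinearSelfMap f) (hmin : ¬ IsMinimalSelfMap f) :
    ∃ (U : Set (Gr r (Cpq p q))) (F : Gr r (Cpq p q) → Gr r (Cpq p q)),
      IsOpen U ∧ closure (typeIDomain r p q) ⊆ U ∧ HolomorphicOn F U ∧
        ∀ W : typeIDomain r p q, F W = f W := by
  obtain ⟨M, hM⟩ := hf
  have hpos := hM.hermForm_mulVec_pos hr hrp
  let T : Cpq p q →L[ℂ] Cpq p q := LinearMap.toContinuousLinearMap M.mulVecLin
  refine ⟨Gr.injLocus r T, Gr.mapPlane T, Gr.isOpen_injLocus T, ?_,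
    Gr.holomorphicOn_mapPlane T, ?_⟩
  · intro W hW v hv hTv
    by_contra hv0
    have hMv : M.mulVec v = 0 := hTv
    rcases (hermForm_nonneg_of_mem_closure hW v hv).eq_or_lt with h | h
    · exact hmin ⟨M, hM, rank_eq_of_null_mem_ker hpos hv0 h.symm hMv⟩
    · have h1 := hpos v h
      simp [hMv, hermForm] at h1
  · intro W
    have hW : (f W).1.1 = W.1.1.map (T : Cpq p q →ₗ[ℂ] Cpq p q) := hM W
    apply Subtype.ext
    rw [Gr.mapPlane_val T W.1 (by rw [← hW]; exact (f W).1.2), hW]
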